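/- Let $F$ be a field of characteristic different from $2$. Let $D$ be a connected diagonalizable algebraic group over $F$ with character group $X$ (a finitely generated abelian group), so that $F[D]=FX$ is the group algebra. Identify $Lie(D)$ with the space of linear maps $y:FX\to F$ such that $y(g_1g_2)=y(g_1)+y(g_2)$ for $g_1,g_2\in X$, and let $x\in Lie(D)$. Let $D_{1,x}$ be the affine supergroup with coordinate superalgebra $F[D_{1,x}]=FX\oplus (FX)z$, where $z$ is odd and $z^2=0$, and with coproduct $$\Delta(h)=h\otimes h+x(h)\,hz\otimes hz\quad (h\in X),\qquad \Delta(z)=1\otimes z+z\otimes 1 .$$ For $h\in X$ let $L(h)=Fh\oplus Fhz\subseteq F[D_{1,x}]$ (a subcomodule), and let $V$ be a $D_{1,x}$-supermodule with $V^*\simeq L(h_1)\oplus\dots\oplus L(h_s)$, where $h_1,\dots,h_s\in X$. Thus $F[V]$ is the polynomial superalgebra freely generated by even elements $f_{j,0}$ and odd elements $f_{j,1}$ $(1\le j\le s)$, all of degree one, and its coaction $\tau:F[V]\to F[V]\otimes F[D_{1,x}]$ is the superalgebra homomorphism with $$\tau(f_{j,0})=f_{j,0}\otimes h_j+x(h_j)f_{j,1}\otimes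 h_jz,\qquad \tau(f_{j,1})=f_{j,0}\otimes h_jz+f_{j,1}\otimes h_j ,$$ where tensor products of superalgebras are multiplied by $(a\otimes b)(c\otimes d)=(-1)^{|b||c|}ac\otimes bd$. Let $F[V]^{D_{1,x}}=\{a:\tau(a)=a\otimes 1\}$, let $\tau|_D:F[V]\to F[V]\otimes FX$ be obtained from $\tau$ by setting $z=0$, and let $A=F[V]^D=\{a: \tau|_D(a)=a\otimes 1\}$. Let $\phi$ be the linear functional on $F[D_{1,x}]$ with $\phi(h)=0$, $\phi(hz)=1$ for $h\in X$, acting on $F[V]$ by $\phi a=(\mathrm{id}\otimes\phi)\tau(a)$. For $G\in\{D,D_{1,x}\}$ let $M_{G,V}=\min\{d>0: F[V]_d\cap F[V]^G\ne 0\}$, and $M_{G,V}=\infty$ if there is no such $d$. Then the following hold. 1. $\phi$ is an odd superderivation of $F[V]$, in the sense that it reverses parity and $\phi(ab)=a\,\phi(b)+(-1)^{|b|}\phi(a)\,b$ for all $a$ and all homogeneous $b$; it satisfies $\phi f_{j,0}=x(h_j)f_{j,1}$ and $\phi f_{j,1}=f_{j,0}$. It preserves degrees and maps $A$ to itself. 2.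 $F[V]^{D_{1,x}}=\{a\in A:\phi a=0\}$. 3. There is a basis $\{v_i\}_{i\in I_1\sqcup I_2}$ of $A$, consisting of elements homogeneous with respect to the degree, such that $\{v_i\}_{i\in I_1}$ is a basis of $\phi A$. For every such basis there is exactly one row-finite matrix $C=(c_{ij})_{i\in I_2,\,j\in I_1}$ over $F$ with $\phi v_i=\sum_{j\in I_1}c_{ij}v_j$ for all $i\in I_2$, and the space $F[V]^{D_{1,x}}$ is spanned by the vectors $v_i$, $i\in I_1$, together with the vectors $\sum_{j\in I_2}d_jv_j$, where $d=(d_j)_{j\in I_2}$ runs over the finitely supported vectors over $F$ with $dC=0$. 4. $M_{D,V}=M_{D_{1,x},V}$. -/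

import Mathlib

open scoped TensorProduct DirectSum

universe u v w

/-! ### Polynomial superalgebras -/

/-- The defining relations `ab = (-1)^{|a||b|} ba` between generators `a, b` with parities given
by `p`. -/
inductive SuperPoly.Rel (F : Type u) [Field F] {κ : Type v} (p : κ → ZMod 2) :
    FreeAlgebra F κ → FreeAlgebra F κ → Prop
  | comm (k l : κ) : SuperPoly.Rel F p (FreeAlgebra.ι F k * FreeAlgebra.ι F l)
      ((-1 : ℤˣ) ^ (p k * p l) • (FreeAlgebra.ι F l * FreeAlgebra.ι F k))

/-- The supercommutative polynomial superalgebra over a field `F` (of characteristic different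
from `2`), freely generated by homogeneous generators indexed by `κ`, the generator `k` having
parity `p k`. -/
def SuperPoly (F : Type u) [Field F] {κ : Type v} (p : κ → ZMod 2) : Type max u v :=
  RingQuot (SuperPoly.Rel F p)

namespace SuperPoly

noncomputable instance instRing (F : Type u) [Field F] {κ : Type v} (p : κ → ZMod 2) :
    Ring (SuperPoly F p) :=
  inferInstanceAs (Ring (RingQuot (SuperPoly.Rel F p)))

noncomputable instance instAlgebra (F : Type u) [Field F] {κ : Type v} (p : κ → ZMod 2) :
    Algebra F (SuperPoly F p) :=
  inferInstanceAs (Algebra F (RingQuot (SuperPoly.Rel F p)))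

/-- The free generators. -/
noncomputable def gen (F : Type u) [Field F] {κ : Type v} (p : κ → ZMod 2) (k : κ) :
    SuperPoly F p :=
  RingQuot.mkAlgHom F (SuperPoly.Rel F p) (FreeAlgebra.ι F k)

theorem gen_mul_gen (F : Type u) [Field F] {κ : Type v} (p : κ → ZMod 2) (k l : κ) :
    gen F p k * gen F p l = (-1 : ℤˣ) ^ (p k * p l) • (gen F p l * gen F p k) := by
  have h := RingQuot.mkAlgHom_rel F (SuperPoly.Rel.comm (F := F) (p := p) k l)
  rw [map_mul, Units.smul_def, map_zsmul, map_mul] at h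
  rw [Units.smul_def]
  exact h

/-- The universal property. -/
noncomputable def lift {F : Type u} [Field F] {κ : Type v} (p : κ → ZMod 2) {T : Type w} [Ring T]
    [Algebra F T] (f : κ → T)
    (hf : ∀ k l, f k * f l = (-1 : ℤˣ) ^ (p k * p l) • (f l * f k)) : SuperPoly F p →ₐ[F] T :=
  RingQuot.liftAlgHom F ⟨FreeAlgebra.lift F f, by
    rintro _ _ ⟨k, l⟩
    rw [map_mul, Units.smul_def, map_zsmul, map_mul, FreeAlgebra.lift_ι_apply,
      FreeAlgebra.lift_ι_apply, ← Units.smul_def]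
    exact hf k l⟩

@[simp]
theorem lift_gen {F : Type u} [Field F] {κ : Type v} (p : κ → ZMod 2) {T : Type w} [Ring T]
    [Algebra F T] (f : κ → T)
    (hf : ∀ k l, f k * f l = (-1 : ℤˣ) ^ (p k * p l) • (f l * f k)) (k : κ) :
    lift p f hf (gen F p k) = f k := by
  have := RingQuot.liftAlgHom_mkAlgHom_apply (S := F) (FreeAlgebra.lift F f)
    (s := SuperPoly.Rel F p) (by
      rintro _ _ ⟨k, l⟩
      rw [map_mul, Units.smul_def, map_zsmul, map_mul, FreeAlgebra.lift_ι_apply,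
        FreeAlgebra.lift_ι_apply, ← Units.smul_def]
      exact hf k l) (FreeAlgebra.ι F k)
  rw [FreeAlgebra.lift_ι_apply] at this
  exact this

theorem algHom_ext {F : Type u} [Field F] {κ : Type v} {p : κ → ZMod 2} {T : Type w} [Ring T]
    [Algebra F T] {f g : SuperPoly F p →ₐ[F] T} (h : ∀ k, f (gen F p k) = g (gen F p k)) :
    f = g := by
  refine RingQuot.ringQuot_ext' F (s := SuperPoly.Rel F p) f g ?_
  refine FreeAlgebra.hom_ext ?_
  funext k
  exact h k

/-- The homogeneous component of weight `m`, where the generator `k` is given weight `W k`: the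
span of all products of generators of total weight `m`. With `W = p` this is the parity grading,
with `W = 1` it is the degree. -/
noncomputable def homog (F : Type u) [Field F] {κ : Type v} (p : κ → ZMod 2) {M : Type w} [AddCommMonoid M]
    (W : κ → M) (m : M) : Submodule F (SuperPoly F p) :=
  Submodule.span F {a | ∃ l : List κ, (l.map W).sum = m ∧ a = (l.map (gen F p)).prod}

theorem gen_mem_homog (F : Type u) [Field F] {κ : Type v} (p : κ → ZMod 2) {M : Type w}
    [AddCommMonoid M] (W : κ → M) (k : κ) : gen F p k ∈ homog F p W (W k) :=
  Submodule.subset_span ⟨[k], by simp, by simp⟩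

noncomputable instance gradedMonoid_homog (F : Type u) [Field F] {κ : Type v} (p : κ → ZMod 2) {M : Type w}
    [AddCommMonoid M] (W : κ → M) : SetLike.GradedMonoid (homog F p W) where
  one_mem := Submodule.subset_span ⟨[], by simp, by simp⟩
  mul_mem i j a b ha hb := by
    have h : homog F p W i * homog F p W j ≤ homog F p W (i + j) := by
      unfold homog
      rw [Submodule.span_mul_span]
      apply Submodule.span_mono
      rintro _ ⟨_, ⟨l, hl, rfl⟩, _, ⟨l', hl', rfl⟩, rfl⟩
      exact ⟨l ++ l', by simp [hl, hl'], by simp⟩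
    exact h (Submodule.mul_mem_mul ha hb)

/-- Splitting into homogeneous components, on the generators. -/
noncomputable def decomposeHom (F : Type u) [Field F] {κ : Type v} (p : κ → ZMod 2) {M : Type w}
    [AddCommMonoid M] [DecidableEq M] (W : κ → M) :
    SuperPoly F p →ₐ[F] ⨁ m, homog F p W m :=
  lift p (fun k => DirectSum.of (fun m => homog F p W m) (W k) ⟨gen F p k, gen_mem_homog F p W k⟩)
    (by
      intro k l
      have h := gen_mul_gen F p k l
      rw [DirectSum.of_mul_of, DirectSum.of_mul_of]
      rcases Int.units_eq_one_or ((-1 : ℤˣ) ^ (p k * p l)) with e | e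
      · rw [e, one_smul] at h ⊢
        exact DirectSum.of_eq_of_gradedMonoid_eq (Sigma.subtype_ext (add_comm _ _) h)
      · rw [e, Units.neg_smul, one_smul] at h
        rw [e]
        refine Eq.trans ?_ (neg_one_zsmul _).symm
        refine Eq.trans ?_ (map_neg (DirectSum.of (fun m => homog F p W m) (W l + W k)) _)
        exact DirectSum.of_eq_of_gradedMonoid_eq (Sigma.subtype_ext (add_comm _ _) h))

noncomputable instance gradedAlgebra_homog (F : Type u) [Field F] {κ : Type v} (p : κ → ZMod 2) {M : Type w}
    [AddCommMonoid M] [DecidableEq M] (W : κ → M) : GradedAlgebra (homog F p W) :=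
  GradedAlgebra.ofAlgHom _ (decomposeHom F p W)
    (by
      refine algHom_ext fun k => ?_
      simp [decomposeHom])
    (by
      rintro m ⟨a, ha⟩
      have key : ∀ l : List κ, decomposeHom F p W (l.map (gen F p)).prod =
          DirectSum.of (fun m => homog F p W m) (l.map W).sum
            ⟨(l.map (gen F p)).prod, Submodule.subset_span ⟨l, rfl, rfl⟩⟩ := by
        intro l
        induction l with
        | nil =>
          have h1 : decomposeHom F p W ([].map (gen F p)).prod = 1 := by simp
          rw [h1]
          rfl
        | cons k l ih =>
          have h1 : decomposeHom F p W ((k :: l).map (gen F p)).prod =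
              decomposeHom F p W (gen F p k) * decomposeHom F p W (l.map (gen F p)).prod := by
            rw [List.map_cons, List.prod_cons, map_mul]
          rw [h1, ih]
          have : decomposeHom F p W (gen F p k) = DirectSum.of (fun m => homog F p W m) (W k)
            ⟨gen F p k, gen_mem_homog F p W k⟩ := lift_gen _ _ _ _
          rw [this, DirectSum.of_mul_of]
          exact DirectSum.of_eq_of_gradedMonoid_eq (Sigma.subtype_ext rfl rfl)
      change decomposeHom F p W a = DirectSum.of (fun m => homog F p W m) m ⟨a, ha⟩
      induction ha using Submodule.span_induction with
      | mem x hx =>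
        obtain ⟨l, rfl, rfl⟩ := hx
        exact key l
      | zero =>
        rw [map_zero]
        exact (map_zero (DirectSum.of (fun m => homog F p W m) m)).symm
      | add x y hx hy ihx ihy => rw [map_add, ihx, ihy, ← map_add]; rfl
      | smul c x hx ih =>
        rw [map_smul, ih]
        exact ((DirectSum.lof F M (fun m => homog F p W m) m).map_smul c ⟨x, hx⟩).symm)

end SuperPoly

/-! ### The supergroup `D_{1,x}` -/

/-- `Lie(D)`, for the diagonalizable group `D` with character group `X` and coordinate algebra the
group algebra `FX`: the linear maps `y : FX → F` with `y(g₁g₂) = y(g₁) + y(g₂)` for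
`g₁, g₂ ∈ X`. -/
def LieD (F : Type u) [Field F] (X : Type v) [CommGroup X] :
    Submodule F (Module.Dual F (MonoidAlgebra F X)) where
  carrier := {y | ∀ g₁ g₂ : X, y (MonoidAlgebra.of F X (g₁ * g₂)) =
    y (MonoidAlgebra.of F X g₁) + y (MonoidAlgebra.of F X g₂)}
  add_mem' {y z} hy hz g₁ g₂ := by
    rw [LinearMap.add_apply, LinearMap.add_apply, LinearMap.add_apply, hy, hz]
    ring
  zero_mem' g₁ g₂ := by simp
  smul_mem' c y hy g₁ g₂ := by
    rw [LinearMap.smul_apply, LinearMap.smul_apply, LinearMap.smul_apply, hy, smul_add]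

/-- The value `x(h)` of `x ∈ Lie(D)` at a character `h ∈ X`. -/
noncomputable def LieD.eval {F : Type u} [Field F] {X : Type v} [CommGroup X] (x : LieD F X)
    (h : X) : F :=
  (x : Module.Dual F (MonoidAlgebra F X)) (MonoidAlgebra.of F X h)

/-- The coordinate superalgebra `F[D_{1,x}] = FX ⊕ (FX)z` with `z` odd, `z² = 0`. (As a
superalgebra it does not depend on `x`; the coproduct does.) -/
abbrev CoordD (F : Type u) [Field F] (X : Type v) [CommGroup X] : Type max u v :=
  DualNumber (MonoidAlgebra F X)

namespace CoordD

/-- A character `h ∈ X`, as an element of `F[D_{1,x}]`. -/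
noncomputable def chr (F : Type u) [Field F] {X : Type v} [CommGroup X] (h : X) : CoordD F X :=
  TrivSqZeroExt.inl (MonoidAlgebra.of F X h)

/-- The odd element `z`. -/
noncomputable def z (F : Type u) [Field F] (X : Type v) [CommGroup X] : CoordD F X :=
  DualNumber.eps

theorem z_mul_z (F : Type u) [Field F] (X : Type v) [CommGroup X] : z F X * z F X = 0 :=
  DualNumber.eps_mul_eps

theorem chr_one (F : Type u) [Field F] (X : Type v) [CommGroup X] : chr F (1 : X) = 1 := by
  rw [chr, map_one, TrivSqZeroExt.inl_one]

theorem chr_mul (F : Type u) [Field F] {X : Type v} [CommGroup X] (h k : X) :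
    chr F (h * k) = chr F h * chr F k := by
  rw [chr, map_mul, TrivSqZeroExt.inl_mul, chr, chr]

/-- The parity grading: the even part is `FX`, the odd part is `(FX)z`. -/
noncomputable def parity (F : Type u) [Field F] (X : Type v) [CommGroup X] (i : ZMod 2) :
    Submodule F (CoordD F X) where
  carrier := {b | (i = 0 → b.snd = 0) ∧ (i = 1 → b.fst = 0)}
  add_mem' {a b} ha hb := ⟨fun h => by simp [ha.1 h, hb.1 h], fun h => by simp [ha.2 h, hb.2 h]⟩
  zero_mem' := ⟨fun _ => rfl, fun _ => rfl⟩
  smul_mem' c b hb := ⟨fun h => by simp [hb.1 h], fun h => by simp [hb.2 h]⟩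

theorem chr_mem (F : Type u) [Field F] {X : Type v} [CommGroup X] (h : X) :
    chr F h ∈ parity F X 0 :=
  ⟨fun _ => TrivSqZeroExt.snd_inl _ _, fun h => absurd h (by decide)⟩

theorem z_mem (F : Type u) [Field F] (X : Type v) [CommGroup X] : z F X ∈ parity F X 1 :=
  ⟨fun h => absurd h (by decide), fun _ => TrivSqZeroExt.fst_inr _ _⟩

noncomputable instance gradedMonoid_parity (F : Type u) [Field F] (X : Type v) [CommGroup X] :
    SetLike.GradedMonoid (parity F X) where
  one_mem := ⟨fun _ => TrivSqZeroExt.snd_one, fun h => absurd h (by decide)⟩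
  mul_mem i j a b ha hb := by
    have h01 : ∀ k : ZMod 2, k = 0 ∨ k = 1 := by decide
    rcases h01 i with rfl | rfl <;> rcases h01 j with rfl | rfl
    · exact ⟨fun _ => by simp [ha.1 rfl, hb.1 rfl], fun h => absurd h (by decide)⟩
    · exact ⟨fun h => absurd h (by decide), fun _ => by simp [hb.2 rfl]⟩
    · exact ⟨fun h => absurd h (by decide), fun _ => by simp [ha.2 rfl]⟩
    · exact ⟨fun _ => by simp [ha.2 rfl, hb.2 rfl], fun h => absurd h (by decide)⟩

/-- The projection of `F[D_{1,x}]` onto its even part `FX`. -/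
noncomputable def evenPart (F : Type u) [Field F] (X : Type v) [CommGroup X] :
    CoordD F X →ₗ[F] parity F X 0 where
  toFun b := ⟨TrivSqZeroExt.inl b.fst, fun _ => TrivSqZeroExt.snd_inl _ _,
    fun h => absurd h (by decide)⟩
  map_add' a b := Subtype.ext (by simp)
  map_smul' c b := Subtype.ext (by simp)

/-- The projection of `F[D_{1,x}]` onto its odd part `(FX)z`. -/
noncomputable def oddPart (F : Type u) [Field F] (X : Type v) [CommGroup X] :
    CoordD F X →ₗ[F] parity F X 1 where
  toFun b := ⟨TrivSqZeroExt.inr b.snd, fun h => absurd h (by decide),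
    fun _ => TrivSqZeroExt.fst_inr _ _⟩
  map_add' a b := Subtype.ext (TrivSqZeroExt.inr_add _ _ _)
  map_smul' c b := Subtype.ext (by simp)

noncomputable instance decomposition_parity (F : Type u) [Field F] (X : Type v) [CommGroup X] :
    DirectSum.Decomposition (parity F X) :=
  DirectSum.Decomposition.ofLinearMap (parity F X)
    (DirectSum.lof F (ZMod 2) (fun i => parity F X i) 0 ∘ₗ evenPart F X +
      DirectSum.lof F (ZMod 2) (fun i => parity F X i) 1 ∘ₗ oddPart F X)
    (by
      ext1 b
      rw [LinearMap.comp_apply, LinearMap.add_apply, map_add, LinearMap.comp_apply,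
        LinearMap.comp_apply, DirectSum.coeLinearMap_lof, DirectSum.coeLinearMap_lof]
      exact TrivSqZeroExt.inl_fst_add_inr_snd_eq b)
    (by
      have h01 : ∀ k : ZMod 2, k = 0 ∨ k = 1 := by decide
      refine DirectSum.linearMap_ext F fun i => ?_
      ext1 b
      rw [LinearMap.comp_apply, LinearMap.comp_apply, DirectSum.coeLinearMap_lof,
        LinearMap.add_apply, LinearMap.comp_apply, LinearMap.comp_apply]
      obtain ⟨b, hb⟩ := b
      rcases h01 i with rfl | rfl
      · have h0 : evenPart F X b = ⟨b, hb⟩ :=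
          Subtype.ext (TrivSqZeroExt.ext rfl (by simpa [evenPart] using (hb.1 rfl).symm))
        have h1 : oddPart F X b = 0 := Subtype.ext (by simp [oddPart, hb.1 rfl])
        simp only [h0, h1, map_zero, add_zero]
        rfl
      · have h0 : evenPart F X b = 0 := Subtype.ext (by simp [evenPart, hb.2 rfl])
        have h1 : oddPart F X b = ⟨b, hb⟩ :=
          Subtype.ext (TrivSqZeroExt.ext (by simpa [oddPart] using (hb.2 rfl).symm) rfl)
        simp only [h0, h1, map_zero, zero_add]
        rfl)

noncomputable instance gradedAlgebra_parity (F : Type u) [Field F] (X : Type v) [CommGroup X] :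
    GradedAlgebra (parity F X) where

/-- Multiplication in a graded tensor product, on homogeneous inner factors. -/
theorem tmul_mul_tmul {F : Type u} [Field F] {A : Type v} {B : Type w} [Ring A] [Ring B]
    [Algebra F A] [Algebra F B] {𝒜 : ZMod 2 → Submodule F A} {ℬ : ZMod 2 → Submodule F B}
    [GradedAlgebra 𝒜] [GradedAlgebra ℬ] {i j : ZMod 2} (a₁ : A) {b₁ : B} {a₂ : A} (b₂ : B)
    (hb : b₁ ∈ ℬ i) (ha : a₂ ∈ 𝒜 j) :
    ((a₁ ᵍ⊗ₜ[F] b₁ : 𝒜 ᵍ⊗[F] ℬ) * (a₂ ᵍ⊗ₜ[F] b₂ : 𝒜 ᵍ⊗[F] ℬ)) =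
      (-1 : ℤˣ) ^ (i * j) • ((a₁ * a₂) ᵍ⊗ₜ[F] (b₁ * b₂) : 𝒜 ᵍ⊗[F] ℬ) :=
  GradedTensorProduct.tmul_coe_mul_coe_tmul 𝒜 ℬ a₁ ⟨b₁, hb⟩ ⟨a₂, ha⟩ b₂

theorem tmul_zero {F : Type u} [Field F] {A : Type v} {B : Type w} [Ring A] [Ring B]
    [Algebra F A] [Algebra F B] {𝒜 : ZMod 2 → Submodule F A} {ℬ : ZMod 2 → Submodule F B}
    [GradedAlgebra 𝒜] [GradedAlgebra ℬ] (a : A) :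
    (a ᵍ⊗ₜ[F] (0 : B) : 𝒜 ᵍ⊗[F] ℬ) = 0 := by
  rw [GradedTensorProduct.tmul, TensorProduct.tmul_zero, map_zero]

theorem zero_tmul {F : Type u} [Field F] {A : Type v} {B : Type w} [Ring A] [Ring B]
    [Algebra F A] [Algebra F B] {𝒜 : ZMod 2 → Submodule F A} {ℬ : ZMod 2 → Submodule F B}
    [GradedAlgebra 𝒜] [GradedAlgebra ℬ] (b : B) :
    ((0 : A) ᵍ⊗ₜ[F] b : 𝒜 ᵍ⊗[F] ℬ) = 0 := by
  rw [GradedTensorProduct.tmul, TensorProduct.zero_tmul, map_zero]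

theorem neg_tmul {F : Type u} [Field F] {A : Type v} {B : Type w} [Ring A] [Ring B]
    [Algebra F A] [Algebra F B] {𝒜 : ZMod 2 → Submodule F A} {ℬ : ZMod 2 → Submodule F B}
    [GradedAlgebra 𝒜] [GradedAlgebra ℬ] (a : A) (b : B) :
    ((-a) ᵍ⊗ₜ[F] b : 𝒜 ᵍ⊗[F] ℬ) = -(a ᵍ⊗ₜ[F] b) := by
  rw [GradedTensorProduct.tmul, TensorProduct.neg_tmul, map_neg]

/-- `F[D_{1,x}] ⊗ F[D_{1,x}]`, with `(a ⊗ b)(c ⊗ d) = (-1)^{|b||c|} ac ⊗ bd`. -/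
abbrev Tensor2 (F : Type u) [Field F] (X : Type v) [CommGroup X] : Type max u v :=
  parity F X ᵍ⊗[F] parity F X

theorem chr_mul_z_mem (F : Type u) [Field F] {X : Type v} [CommGroup X] (h : X) :
    chr F h * z F X ∈ parity F X 1 := by
  simpa using SetLike.GradedMul.mul_mem (chr_mem F h) (z_mem F X)

/-- `Δ(h) = h ⊗ h + x(h) hz ⊗ hz`, for `h ∈ X`. -/
noncomputable def comulChr {F : Type u} [Field F] {X : Type v} [CommGroup X] (x : LieD F X)
    (h : X) : Tensor2 F X :=
  chr F h ᵍ⊗ₜ[F] chr F h + LieD.eval x h • ((chr F h * z F X) ᵍ⊗ₜ[F] (chr F h * z F X))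

/-- `Δ(z) = 1 ⊗ z + z ⊗ 1`. -/
noncomputable def comulZ (F : Type u) [Field F] (X : Type v) [CommGroup X] : Tensor2 F X :=
  1 ᵍ⊗ₜ[F] z F X + z F X ᵍ⊗ₜ[F] 1

end CoordD

theorem LieD.eval_one {F : Type u} [Field F] {X : Type v} [CommGroup X] (x : LieD F X) :
    LieD.eval x 1 = 0 := by
  have h := x.2 1 1
  rw [mul_one] at h
  exact left_eq_add.mp h

theorem LieD.eval_mul {F : Type u} [Field F] {X : Type v} [CommGroup X] (x : LieD F X) (h k : X) :
    LieD.eval x (h * k) = LieD.eval x h + LieD.eval x k :=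
  x.2 h k

namespace CoordD

theorem comulChr_mul {F : Type u} [Field F] {X : Type v} [CommGroup X] (x : LieD F X) (h k : X) :
    comulChr x (h * k) = comulChr x h * comulChr x k := by
  have e1 : chr F h * z F X * (chr F k * z F X) = 0 := by
    rw [mul_mul_mul_comm, z_mul_z, mul_zero]
  have e2 : chr F h * (chr F k * z F X) = chr F (h * k) * z F X := by rw [chr_mul, mul_assoc]
  have e3 : chr F h * z F X * chr F k = chr F (h * k) * z F X := by rw [chr_mul, mul_right_comm]
  unfold comulChr
  rw [add_mul, mul_add, mul_add, smul_mul_smul_comm, smul_mul_assoc, mul_smul_comm,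
    tmul_mul_tmul _ _ (chr_mem F h) (chr_mem F k),
    tmul_mul_tmul _ _ (chr_mem F h) (chr_mul_z_mem F k),
    tmul_mul_tmul _ _ (chr_mul_z_mem F h) (chr_mem F k),
    tmul_mul_tmul _ _ (chr_mul_z_mem F h) (chr_mul_z_mem F k), e1, e2, e3, ← chr_mul,
    LieD.eval_mul]
  simp only [mul_zero, zero_mul, uzpow_zero, one_smul, zero_tmul, smul_zero,
    add_zero, add_smul]
  abel

theorem comulChr_one {F : Type u} [Field F] {X : Type v} [CommGroup X] (x : LieD F X) :
    comulChr x 1 = 1 := by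
  rw [comulChr, LieD.eval_one, zero_smul, add_zero, chr_one]
  rfl

theorem comulZ_mul_comulZ (F : Type u) [Field F] (X : Type v) [CommGroup X] :
    comulZ F X * comulZ F X = 0 := by
  have h1 : (1 : CoordD F X) ∈ parity F X 0 := SetLike.GradedOne.one_mem
  unfold comulZ
  rw [add_mul, mul_add, mul_add, tmul_mul_tmul _ _ (z_mem F X) h1,
    tmul_mul_tmul _ _ (z_mem F X) (z_mem F X), tmul_mul_tmul _ _ h1 h1,
    tmul_mul_tmul _ _ h1 (z_mem F X), z_mul_z]
  simp [tmul_zero, zero_tmul]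

theorem comulZ_comm {F : Type u} [Field F] {X : Type v} [CommGroup X] (x : LieD F X) (h : X) :
    comulZ F X * comulChr x h = comulChr x h * comulZ F X := by
  have h1 : (1 : CoordD F X) ∈ parity F X 0 := SetLike.GradedOne.one_mem
  have e1 : z F X * (chr F h * z F X) = 0 := by rw [mul_left_comm, z_mul_z, mul_zero]
  have e2 : chr F h * z F X * z F X = 0 := by rw [mul_assoc, z_mul_z, mul_zero]
  unfold comulZ comulChr
  rw [add_mul, mul_add, mul_add, add_mul, mul_add, mul_add]
  simp only [smul_mul_assoc, mul_smul_comm]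
  rw [tmul_mul_tmul _ _ (z_mem F X) (chr_mem F h),
    tmul_mul_tmul _ _ (z_mem F X) (chr_mul_z_mem F h),
    tmul_mul_tmul _ _ h1 (chr_mem F h), tmul_mul_tmul _ _ h1 (chr_mul_z_mem F h),
    tmul_mul_tmul _ _ (chr_mem F h) h1, tmul_mul_tmul _ _ (chr_mem F h) (z_mem F X),
    tmul_mul_tmul _ _ (chr_mul_z_mem F h) h1, tmul_mul_tmul _ _ (chr_mul_z_mem F h) (z_mem F X),
    e1, e2, mul_comm (z F X) (chr F h)]
  simp [tmul_zero, zero_tmul]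

/-- The coproduct of the supergroup `D_{1,x}`: the superalgebra homomorphism with
`Δ(h) = h ⊗ h + x(h) hz ⊗ hz` for `h ∈ X` and `Δ(z) = 1 ⊗ z + z ⊗ 1`. -/
noncomputable def comul {F : Type u} [Field F] {X : Type v} [CommGroup X] (x : LieD F X) :
    CoordD F X →ₐ[F] Tensor2 F X :=
  DualNumber.lift
    ⟨(MonoidAlgebra.lift F (Tensor2 F X) X
        { toFun := comulChr x
          map_one' := comulChr_one x
          map_mul' := comulChr_mul x }, comulZ F X), comulZ_mul_comulZ F X, by
      intro a
      induction a using MonoidAlgebra.induction_on with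
      | of h =>
        rw [MonoidAlgebra.lift_of]
        exact comulZ_comm x h
      | add a b ha hb =>
        rw [map_add]
        exact ha.add_right hb
      | smul c a ha =>
        rw [map_smul]
        exact ha.smul_right c⟩

theorem comul_chr {F : Type u} [Field F] {X : Type v} [CommGroup X] (x : LieD F X) (h : X) :
    comul x (chr F h) = comulChr x h := by
  rw [comul, chr, DualNumber.lift_apply_inl, MonoidAlgebra.lift_of]
  rfl

theorem comul_z {F : Type u} [Field F] {X : Type v} [CommGroup X] (x : LieD F X) :
    comul x (z F X) = comulZ F X := by
  rw [comul, z, DualNumber.lift_apply_eps]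

theorem comul_chr_mul_z {F : Type u} [Field F] {X : Type v} [CommGroup X] (x : LieD F X)
    (h : X) : comul x (chr F h * z F X) =
      chr F h ᵍ⊗ₜ[F] (chr F h * z F X) + (chr F h * z F X) ᵍ⊗ₜ[F] chr F h := by
  have h1 : (1 : CoordD F X) ∈ parity F X 0 := SetLike.GradedOne.one_mem
  have e2 : chr F h * z F X * z F X = 0 := by rw [mul_assoc, z_mul_z, mul_zero]
  rw [map_mul, comul_chr, comul_z, comulChr, comulZ, add_mul, mul_add, mul_add]
  simp only [smul_mul_assoc]
  rw [tmul_mul_tmul _ _ (chr_mem F h) h1, tmul_mul_tmul _ _ (chr_mem F h) (z_mem F X),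
    tmul_mul_tmul _ _ (chr_mul_z_mem F h) h1, tmul_mul_tmul _ _ (chr_mul_z_mem F h) (z_mem F X),
    e2]
  simp [tmul_zero, zero_tmul]

end CoordD

/-! ### The superalgebra `F[V]` and its coaction -/

/-- The polynomial superalgebra `F[V]`, for a `D_{1,x}`-supermodule `V` with
`V* ≅ L(h₁) ⊕ ⋯ ⊕ L(h_s)`. It is freely generated by even elements `f_{j,0}` and odd elements
`f_{j,1}`, for `1 ≤ j ≤ s`; the generator `f_{j,a}` has index `(j, a)`. -/
abbrev FV (F : Type u) [Field F] (s : ℕ) : Type u :=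
  SuperPoly F (fun k : Fin s × ZMod 2 => k.2)

namespace FV

/-- The generator `f_{j,a}`. -/
noncomputable def f (F : Type u) [Field F] {s : ℕ} (j : Fin s) (a : ZMod 2) : FV F s :=
  SuperPoly.gen F (fun k : Fin s × ZMod 2 => k.2) (j, a)

/-- The parity grading of `F[V]`. -/
noncomputable abbrev parity (F : Type u) [Field F] (s : ℕ) : ZMod 2 → Submodule F (FV F s) :=
  SuperPoly.homog F (fun k : Fin s × ZMod 2 => k.2) (fun k : Fin s × ZMod 2 => k.2)

/-- The homogeneous component `F[V]_d` of degree `d`; all the `f_{j,a}` have degree one. -/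
noncomputable abbrev degree (F : Type u) [Field F] (s : ℕ) : ℕ → Submodule F (FV F s) :=
  SuperPoly.homog F (fun k : Fin s × ZMod 2 => k.2) (fun _ => 1)

theorem f_mem (F : Type u) [Field F] {s : ℕ} (j : Fin s) (a : ZMod 2) : f F j a ∈ parity F s a :=
  SuperPoly.gen_mem_homog F _ _ (j, a)

/-- The linear map that carries the basis `f₀ = h`, `f₁ = hz` of the direct summand `L(h)` of
`F[D_{1,x}]` to the copy `f_{j,0}, f_{j,1}` of it in `V*`, and that vanishes on the other
summands `L(h')`. -/
noncomputable def ofL (F : Type u) [Field F] {X : Type v} [CommGroup X] {s : ℕ} (h : X)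
    (j : Fin s) : CoordD F X →ₗ[F] FV F s where
  toFun b := b.fst.coeff h • f F j 0 + b.snd.coeff h • f F j 1
  map_add' a b := by
    simp only [TrivSqZeroExt.fst_add, TrivSqZeroExt.snd_add, MonoidAlgebra.coeff_add,
      Finsupp.add_apply, add_smul]
    abel
  map_smul' c b := by
    simp only [TrivSqZeroExt.fst_smul, TrivSqZeroExt.snd_smul, MonoidAlgebra.coeff_smul,
      Finsupp.smul_apply, smul_add, smul_smul, smul_eq_mul, RingHom.id_apply]

theorem ofL_apply (F : Type u) [Field F] {X : Type v} [CommGroup X] {s : ℕ} (h : X)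
    (j : Fin s) (b : CoordD F X) :
    ofL F h j b = b.fst.coeff h • f F j 0 + b.snd.coeff h • f F j 1 := rfl

theorem ofL_chr (F : Type u) [Field F] {X : Type v} [CommGroup X] {s : ℕ} (h : X)
    (j : Fin s) : ofL F h j (CoordD.chr F h) = f F j 0 := by
  rw [ofL_apply, CoordD.chr, TrivSqZeroExt.fst_inl, TrivSqZeroExt.snd_inl]
  simp

theorem ofL_chr_mul_z (F : Type u) [Field F] {X : Type v} [CommGroup X] {s : ℕ} (h : X)
    (j : Fin s) : ofL F h j (CoordD.chr F h * CoordD.z F X) = f F j 1 := by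
  rw [ofL_apply, CoordD.chr, CoordD.z, TrivSqZeroExt.fst_mul, TrivSqZeroExt.snd_mul,
    TrivSqZeroExt.fst_inl, TrivSqZeroExt.snd_inl, DualNumber.fst_eps, DualNumber.snd_eps]
  simp

/-- `F[V] ⊗ F[D_{1,x}]`, with `(a ⊗ b)(c ⊗ d) = (-1)^{|b||c|} ac ⊗ bd`. -/
abbrev Target (F : Type u) [Field F] (X : Type v) [CommGroup X] (s : ℕ) : Type max u v :=
  parity F s ᵍ⊗[F] CoordD.parity F X

/-- The coaction on the generators: the coaction of the subcomodule `L(h_j)` of `F[D_{1,x}]`,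
which is the restriction of the coproduct. -/
noncomputable def coactGen {F : Type u} [Field F] {X : Type v} [CommGroup X] (x : LieD F X)
    {s : ℕ} (h : Fin s → X) (k : Fin s × ZMod 2) : Target F X s :=
  GradedTensorProduct.of F (parity F s) (CoordD.parity F X)
    (TensorProduct.map (ofL F (h k.1) k.1) LinearMap.id
      ((GradedTensorProduct.of F (CoordD.parity F X) (CoordD.parity F X)).symm
        (CoordD.comul x (CoordD.chr F (h k.1) * CoordD.z F X ^ k.2.val))))

theorem coactGen_zero {F : Type u} [Field F] {X : Type v} [CommGroup X] (x : LieD F X)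
    {s : ℕ} (h : Fin s → X) (j : Fin s) :
    coactGen x h (j, 0) = f F j 0 ᵍ⊗ₜ[F] CoordD.chr F (h j) +
      LieD.eval x (h j) • (f F j 1 ᵍ⊗ₜ[F] (CoordD.chr F (h j) * CoordD.z F X)) := by
  rw [coactGen, ZMod.val_zero, pow_zero, mul_one, CoordD.comul_chr, CoordD.comulChr, map_add,
    map_smul, GradedTensorProduct.of_symm_of, GradedTensorProduct.of_symm_of, map_add, map_smul,
    TensorProduct.map_tmul, TensorProduct.map_tmul, ofL_chr, ofL_chr_mul_z, map_add, map_smul]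
  rfl

theorem coactGen_one {F : Type u} [Field F] {X : Type v} [CommGroup X] (x : LieD F X)
    {s : ℕ} (h : Fin s → X) (j : Fin s) :
    coactGen x h (j, 1) = f F j 0 ᵍ⊗ₜ[F] (CoordD.chr F (h j) * CoordD.z F X) +
      f F j 1 ᵍ⊗ₜ[F] CoordD.chr F (h j) := by
  rw [coactGen, ZMod.val_one, pow_one, CoordD.comul_chr_mul_z, map_add,
    GradedTensorProduct.of_symm_of, GradedTensorProduct.of_symm_of, map_add,
    TensorProduct.map_tmul, TensorProduct.map_tmul, ofL_chr, ofL_chr_mul_z, map_add]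
  rfl

theorem coactGen_eq {F : Type u} [Field F] {X : Type v} [CommGroup X] (x : LieD F X)
    {s : ℕ} (h : Fin s → X) (j : Fin s) (a : ZMod 2) :
    ∃ c : F, coactGen x h (j, a) = f F j a ᵍ⊗ₜ[F] CoordD.chr F (h j) +
      c • (f F j (a + 1) ᵍ⊗ₜ[F] (CoordD.chr F (h j) * CoordD.z F X)) := by
  have h01 : a = 0 ∨ a = 1 := by revert a; decide
  rcases h01 with rfl | rfl
  · exact ⟨_, coactGen_zero x h j⟩
  · exact ⟨1, by rw [coactGen_one, one_smul, add_comm]; rfl⟩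

theorem coactGen_comm {F : Type u} [Field F] {X : Type v} [CommGroup X] (x : LieD F X)
    {s : ℕ} (h : Fin s → X) (k l : Fin s × ZMod 2) :
    coactGen x h k * coactGen x h l =
      (-1 : ℤˣ) ^ (k.2 * l.2) • (coactGen x h l * coactGen x h k) := by
  obtain ⟨i, a⟩ := k
  obtain ⟨j, b⟩ := l
  obtain ⟨c, hc⟩ := coactGen_eq x h i a
  obtain ⟨d, hd⟩ := coactGen_eq x h j b
  have e1 : ∀ p q : X, CoordD.chr F p * CoordD.z F X * (CoordD.chr F q * CoordD.z F X) = 0 := by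
    intro p q
    rw [mul_mul_mul_comm, CoordD.z_mul_z, mul_zero]
  have e2 : ∀ p q : X, CoordD.chr F p * (CoordD.chr F q * CoordD.z F X) =
      CoordD.chr F (p * q) * CoordD.z F X := by
    intro p q
    rw [CoordD.chr_mul, mul_assoc]
  have e3 : ∀ p q : X, CoordD.chr F p * CoordD.z F X * CoordD.chr F q =
      CoordD.chr F (p * q) * CoordD.z F X := by
    intro p q
    rw [CoordD.chr_mul, mul_right_comm]
  have g : ∀ a b : ZMod 2, f F i a * f F j b = (-1 : ℤˣ) ^ (a * b) • (f F j b * f F i a) :=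
    fun a b => SuperPoly.gen_mul_gen F _ (i, a) (j, b)
  have u : (-1 : ℤˣ) ^ ((1 : ZMod 2) + 1) = 1 := by
    rw [show (1 : ZMod 2) + 1 = 0 from rfl, uzpow_zero]
  rw [hc, hd, add_mul, mul_add, mul_add, add_mul, mul_add, mul_add]
  simp only [smul_mul_assoc, mul_smul_comm]
  rw [CoordD.tmul_mul_tmul _ _ (CoordD.chr_mem F (h i)) (f_mem F j b),
    CoordD.tmul_mul_tmul _ _ (CoordD.chr_mem F (h i)) (f_mem F j (b + 1)),
    CoordD.tmul_mul_tmul _ _ (CoordD.chr_mul_z_mem F (h i)) (f_mem F j b),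
    CoordD.tmul_mul_tmul _ _ (CoordD.chr_mul_z_mem F (h i)) (f_mem F j (b + 1)),
    CoordD.tmul_mul_tmul _ _ (CoordD.chr_mem F (h j)) (f_mem F i a),
    CoordD.tmul_mul_tmul _ _ (CoordD.chr_mem F (h j)) (f_mem F i (a + 1)),
    CoordD.tmul_mul_tmul _ _ (CoordD.chr_mul_z_mem F (h j)) (f_mem F i a),
    CoordD.tmul_mul_tmul _ _ (CoordD.chr_mul_z_mem F (h j)) (f_mem F i (a + 1)),
    e1, e1, e2, e2, e3, e3, ← CoordD.chr_mul, ← CoordD.chr_mul, mul_comm (h j) (h i),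
    g a b, g a (b + 1), g (a + 1) b]
  have h01 : ∀ a : ZMod 2, a = 0 ∨ a = 1 := by decide
  rcases h01 a with rfl | rfl <;> rcases h01 b with rfl | rfl
  all_goals
    simp [CoordD.tmul_zero, CoordD.neg_tmul, u]
    abel

/-- The coaction `τ : F[V] → F[V] ⊗ F[D_{1,x}]`: the superalgebra homomorphism with
`τ(f_{j,0}) = f_{j,0} ⊗ h_j + x(h_j) f_{j,1} ⊗ h_j z` and
`τ(f_{j,1}) = f_{j,0} ⊗ h_j z + f_{j,1} ⊗ h_j`. -/
noncomputable def coact {F : Type u} [Field F] {X : Type v} [CommGroup X] (x : LieD F X)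
    {s : ℕ} (h : Fin s → X) : FV F s →ₐ[F] Target F X s :=
  SuperPoly.lift _ (coactGen x h) (coactGen_comm x h)

theorem coact_f_zero {F : Type u} [Field F] {X : Type v} [CommGroup X] (x : LieD F X)
    {s : ℕ} (h : Fin s → X) (j : Fin s) :
    coact x h (f F j 0) = f F j 0 ᵍ⊗ₜ[F] CoordD.chr F (h j) +
      LieD.eval x (h j) • (f F j 1 ᵍ⊗ₜ[F] (CoordD.chr F (h j) * CoordD.z F X)) :=
  (SuperPoly.lift_gen _ _ _ _).trans (coactGen_zero x h j)

theorem coact_f_one {F : Type u} [Field F] {X : Type v} [CommGroup X] (x : LieD F X)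
    {s : ℕ} (h : Fin s → X) (j : Fin s) :
    coact x h (f F j 1) = f F j 0 ᵍ⊗ₜ[F] (CoordD.chr F (h j) * CoordD.z F X) +
      f F j 1 ᵍ⊗ₜ[F] CoordD.chr F (h j) :=
  (SuperPoly.lift_gen _ _ _ _).trans (coactGen_one x h j)

/-- The coaction as a linear map to the plain tensor product. -/
noncomputable def coactLin {F : Type u} [Field F] {X : Type v} [CommGroup X] (x : LieD F X)
    {s : ℕ} (h : Fin s → X) : FV F s →ₗ[F] FV F s ⊗[F] CoordD F X :=
  (GradedTensorProduct.of F (parity F s) (CoordD.parity F X)).symm.toLinearMap ∘ₗ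
    (coact x h).toLinearMap

/-- The invariants `F[V]^{D_{1,x}}`: all `a ∈ F[V]` with `τ(a) = a ⊗ 1`. -/
noncomputable def invariants {F : Type u} [Field F] {X : Type v} [CommGroup X] (x : LieD F X)
    {s : ℕ} (h : Fin s → X) : Submodule F (FV F s) :=
  LinearMap.eqLocus (coactLin x h) ((TensorProduct.mk F (FV F s) (CoordD F X)).flip 1)

/-- The restriction `τ|_D : F[V] → F[V] ⊗ FX` of the coaction to `D`, the largest even
subsupergroup of `D_{1,x}`, which is given by the ideal generated by `z`. -/
noncomputable def coactD {F : Type u} [Field F] {X : Type v} [CommGroup X] (x : LieD F X)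
    {s : ℕ} (h : Fin s → X) : FV F s →ₗ[F] FV F s ⊗[F] MonoidAlgebra F X :=
  TensorProduct.map LinearMap.id
    (TrivSqZeroExt.fstHom F (MonoidAlgebra F X) (MonoidAlgebra F X)).toLinearMap ∘ₗ coactLin x h

/-- The invariants `F[V]^D`: all `a ∈ F[V]` with `τ|_D(a) = a ⊗ 1`. -/
noncomputable def invariantsD {F : Type u} [Field F] {X : Type v} [CommGroup X] (x : LieD F X)
    {s : ℕ} (h : Fin s → X) : Submodule F (FV F s) :=
  LinearMap.eqLocus (coactD x h) ((TensorProduct.mk F (FV F s) (MonoidAlgebra F X)).flip 1)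

/-- The odd element `φ` of `Lie(D_{1,x})`, as a functional on `F[D_{1,x}]`: `φ(h) = 0` and
`φ(hz) = 1` for `h ∈ X`. -/
noncomputable def phiFunctional (F : Type u) [Field F] (X : Type v) [CommGroup X] :
    CoordD F X →ₗ[F] F where
  toFun b := MonoidAlgebra.lift F F X 1 b.snd
  map_add' a b := by rw [TrivSqZeroExt.snd_add, map_add]
  map_smul' c b := by rw [TrivSqZeroExt.snd_smul, map_smul, RingHom.id_apply]

/-- The action of `φ` on `F[V]`: the composite of the coaction with `id ⊗ φ`. -/
noncomputable def phi {F : Type u} [Field F] {X : Type v} [CommGroup X] (x : LieD F X)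
    {s : ℕ} (h : Fin s → X) : FV F s →ₗ[F] FV F s :=
  (TensorProduct.rid F (FV F s)).toLinearMap ∘ₗ
    TensorProduct.map LinearMap.id (phiFunctional F X) ∘ₗ coactLin x h

/-- The minimal positive degree of a nonzero homogeneous element of a subspace of `F[V]`, and `⊤`
if there is none. For the invariants of a (super)group `G` this is `M_{G,V}`. -/
noncomputable def minDegree {F : Type u} [Field F] {s : ℕ} (A : Submodule F (FV F s)) : ℕ∞ :=
  ⨅ d ∈ {d : ℕ | 0 < d ∧ A ⊓ degree F s d ≠ ⊥}, (d : ℕ∞)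

/-- `{v_i}`, for `i ∈ I₁ ⊔ I₂`, is a homogeneous basis of the graded subspace `A`, such that the
`v_i` with `i ∈ I₁` form a basis of `φA` (hence those with `i ∈ I₂` form a basis modulo `φA`). -/
structure IsAdaptedBasis {F : Type u} [Field F] {s : ℕ} (A : Submodule F (FV F s))
    (φ : FV F s →ₗ[F] FV F s) {I₁ I₂ : Type w} (b : I₁ ⊕ I₂ → FV F s) : Prop where
  homogeneous : ∀ i, ∃ d, b i ∈ degree F s d
  linearIndependent : LinearIndependent F b
  span_eq : Submodule.span F (Set.range b) = A
  span_image : Submodule.span F (Set.range (b ∘ Sum.inl)) = A.map φ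

/-- `C = (c_{ij})`, for `i ∈ I₂` and `j ∈ I₁`, is row-finite, with `φ v_i = ∑_j c_{ij} v_j`. -/
def IsCoeffMatrix {F : Type u} [Field F] {s : ℕ} (φ : FV F s →ₗ[F] FV F s) {I₁ I₂ : Type w}
    (b : I₁ ⊕ I₂ → FV F s) (C : Matrix I₂ I₁ F) : Prop :=
  ∀ i, {j | C i j ≠ 0}.Finite ∧ φ (b (Sum.inr i)) = ∑ᶠ j, C i j • b (Sum.inl j)

end FV

/-! On a vector `a` of weight `g` for `D`, the coaction is `τ a = a ⊗ g + φ a ⊗ gz`, because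
`z² = 0`. Multiplicativity of `τ` therefore makes `φ` an odd superderivation of weight `1` and
degree `0`, and `φ²`, a derivation multiplying each generator `f_{j,a}` by `x(h_j)`, multiplies
vectors of weight `g` by `x(g)`. On `A = F[V]^D`, the space of weight `1`, we get
`τ a = a ⊗ 1 + φ a ⊗ z` and `φ² = 0`. So `φ` is a differential on `A` whose kernel is
`F[V]^{D_{1,x}}`, and a nonzero `a ∈ A` yields a nonzero invariant of the same degree: `φ a`, or
`a` itself if `φ a = 0`. -/

theorem exists_linearIndependent_sum_span_eq {K : Type u} [DivisionRing K] {V : Type v}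
    [AddCommGroup V] [Module K V] {S T : Set V} (hST : S ⊆ T) :
    ∃ (I₁ I₂ : Type v) (b : I₁ ⊕ I₂ → V), LinearIndependent K b ∧ (∀ i, b i ∈ T) ∧
      Submodule.span K (Set.range (b ∘ Sum.inl)) = Submodule.span K S ∧
      Submodule.span K (Set.range b) = Submodule.span K T := by
  obtain ⟨B, hBS, span_B, hB⟩ := exists_linearIndependent K S
  obtain ⟨C, hCT, hBC, hTC, hC⟩ := exists_linearIndepOn_id_extension hB (hBS.trans hST)
  let b : B ⊕ (C \ B : Set V) → V := Sum.elim (↑) (↑)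
  have range_b : Set.range b = C := by
    rw [Set.Sum.elim_range, Subtype.range_coe, Subtype.range_coe, Set.union_sdiff_cancel hBC]
  have b_injective : Function.Injective b :=
    Subtype.val_injective.sumElim Subtype.val_injective fun i j e => j.2.2 (e ▸ i.2)
  refine ⟨B, (C \ B : Set V), b, ?_, fun i => hCT (range_b ▸ Set.mem_range_self i), ?_, ?_⟩
  · rwa [← linearIndepOn_id_range_iff b_injective, range_b]
  · rw [Sum.elim_comp_inl, Subtype.range_coe, span_B]
  · rw [range_b]
    exact le_antisymm (Submodule.span_mono hCT) (Submodule.span_le.2 hTC)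

/-- An odd superderivation of a superalgebra with parity grading `𝒜`. The sign convention is that
of an operator acting from the right: it moves past the right-hand factor. -/
structure IsOddDerivation {R : Type u} [CommRing R] {A : Type v} [Ring A] [Algebra R A]
    (𝒜 : ZMod 2 → Submodule R A) (D : A →ₗ[R] A) : Prop where
  map_mem : ∀ i, ∀ a ∈ 𝒜 i, D a ∈ 𝒜 (i + 1)
  map_mul : ∀ i a, ∀ b ∈ 𝒜 i, D (a * b) = a * D b + (-1 : ℤˣ) ^ i • (D a * b)

namespace IsOddDerivation

variable {R : Type u} [CommRing R] {A : Type v} [Ring A] [Algebra R A] {𝒜 : ZMod 2 → Submodule R A}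
  {D : A →ₗ[R] A}

theorem map_one [SetLike.GradedOne 𝒜] (hD : IsOddDerivation 𝒜 D) : D 1 = 0 := by
  simpa using hD.map_mul 0 1 1 SetLike.GradedOne.one_mem

theorem map_map_mul (hD : IsOddDerivation 𝒜 D) {i : ZMod 2} (a : A) {b : A} (hb : b ∈ 𝒜 i) :
    D (D (a * b)) = a * D (D b) + D (D a) * b := by
  have sign_cancel : (-1 : ℤˣ) ^ (i + 1) • (D a * D b) = -((-1 : ℤˣ) ^ i • (D a * D b)) := by
    rw [uzpow_add, uzpow_one, mul_neg_one, Units.neg_smul]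
  have sign_out : D ((-1 : ℤˣ) ^ i • (D a * b)) = (-1 : ℤˣ) ^ i • D (D a * b) := by
    rw [Units.smul_def, map_zsmul, ← Units.smul_def]
  rw [hD.map_mul i a b hb, map_add, hD.map_mul (i + 1) a _ (hD.map_mem i b hb), sign_cancel,
    sign_out, hD.map_mul i _ b hb, smul_add, smul_smul, Int.units_mul_self, one_smul]
  abel

end IsOddDerivation

namespace SuperPoly

section Monomials

variable {F : Type u} [Field F] {κ : Type v} {p : κ → ZMod 2} {M : Type w} [AddCommMonoid M]
  {W : κ → M}

theorem homog_le_of_mul_gen_mem {N : M → Submodule F (SuperPoly F p)} (one_mem : 1 ∈ N 0)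
    (mul_gen_mem : ∀ m k, ∀ a ∈ homog F p W m, a ∈ N m → a * gen F p k ∈ N (m + W k)) (m : M) :
    homog F p W m ≤ N m := by
  refine Submodule.span_le.2 ?_
  rintro _ ⟨l, rfl, rfl⟩
  induction l using List.reverseRecOn with
  | nil => simpa using one_mem
  | append_singleton l k ih =>
    simpa using mul_gen_mem _ k _ (Submodule.subset_span ⟨l, rfl, rfl⟩) ih

theorem iSup_homog (F : Type u) [Field F] (p : κ → ZMod 2) (W : κ → M) :
    ⨆ m, homog F p W m = ⊤ := by
  classical
  exact (DirectSum.Decomposition.isInternal (homog F p W)).submodule_iSup_eq_top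

theorem homog_le_span_inter_homog {M' : Type*} [AddCommMonoid M'] (W' : κ → M') (m : M) :
    homog F p W m ≤
      Submodule.span F {a | a ∈ homog F p W m ∧ ∃ m', a ∈ homog F p W' m'} := by
  refine Submodule.span_mono ?_
  rintro _ ⟨l, rfl, rfl⟩
  exact ⟨Submodule.subset_span ⟨l, rfl, rfl⟩, _, Submodule.subset_span ⟨l, rfl, rfl⟩⟩

end Monomials

section OddDerivation

variable {F : Type u} [Field F] {κ : Type v} {p : κ → ZMod 2}
  {D : SuperPoly F p →ₗ[F] SuperPoly F p}

theorem map_mem_homog_of_map_mul_gen {M : Type w} [AddCommMonoid M] {W : κ → M} {δ : M}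
    (map_one : D 1 = 0)
    (map_mul_gen : ∀ a k, D (a * gen F p k) =
      a * D (gen F p k) + (-1 : ℤˣ) ^ p k • (D a * gen F p k))
    (map_gen_mem : ∀ k, D (gen F p k) ∈ homog F p W (W k + δ)) {m : M} {a : SuperPoly F p}
    (ha : a ∈ homog F p W m) : D a ∈ homog F p W (m + δ) := by
  refine homog_le_of_mul_gen_mem (N := fun m => (homog F p W (m + δ)).comap D)
    (by simp [map_one]) (fun m k a ha hDa => ?_) m ha
  rw [Submodule.mem_comap, map_mul_gen, Units.smul_def]
  refine add_mem ?_ (zsmul_mem ?_ _)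
  · rw [add_assoc]
    exact SetLike.mul_mem_graded ha (map_gen_mem k)
  · rw [add_right_comm]
    exact SetLike.mul_mem_graded hDa (gen_mem_homog F p W k)

theorem isOddDerivation_of_map_mul_gen (map_one : D 1 = 0)
    (map_mul_gen : ∀ a k, D (a * gen F p k) =
      a * D (gen F p k) + (-1 : ℤˣ) ^ p k • (D a * gen F p k))
    (map_gen_mem : ∀ k, D (gen F p k) ∈ homog F p p (p k + 1)) :
    IsOddDerivation (homog F p p) D where
  map_mem _ _ := map_mem_homog_of_map_mul_gen map_one map_mul_gen map_gen_mem
  map_mul i a b hb := by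
    refine homog_le_of_mul_gen_mem
      (N := fun i => LinearMap.eqLocus (D ∘ₗ LinearMap.mulLeft F a)
        (LinearMap.mulLeft F a ∘ₗ D + (-1 : ℤˣ) ^ i • LinearMap.mulLeft F (D a)))
      (by simp [map_one]) (fun i k b _ hb => ?_) i hb
    have hb : D (a * b) = a * D b + (-1 : ℤˣ) ^ i • (D a * b) := hb
    change D (a * (b * gen F p k)) =
      a * D (b * gen F p k) + (-1 : ℤˣ) ^ (i + p k) • (D a * (b * gen F p k))
    rw [← mul_assoc, map_mul_gen, map_mul_gen, hb, mul_add, add_mul, smul_add, uzpow_add, mul_comm,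
      mul_smul, mul_smul_comm, smul_mul_assoc, mul_assoc, mul_assoc, mul_assoc, add_assoc]

end OddDerivation

end SuperPoly

namespace IsOddDerivation

open SuperPoly

variable {F : Type u} [Field F] {κ : Type v} {p : κ → ZMod 2}
  {D : SuperPoly F p →ₗ[F] SuperPoly F p}

theorem map_mem_homog (hD : IsOddDerivation (homog F p p) D) {M : Type w}
    [AddCommMonoid M] {W : κ → M} {δ : M}
    (map_gen_mem : ∀ k, D (gen F p k) ∈ homog F p W (W k + δ)) {m : M} {a : SuperPoly F p}
    (ha : a ∈ homog F p W m) : D a ∈ homog F p W (m + δ) :=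
  map_mem_homog_of_map_mul_gen hD.map_one
    (fun a k => hD.map_mul (p k) a _ (gen_mem_homog F p p k)) map_gen_mem ha

theorem map_map_eq_smul (hD : IsOddDerivation (homog F p p) D) {M : Type w}
    [AddCommMonoid M] {W : κ → M} (χ : M →+ F)
    (map_map_gen : ∀ k, D (D (gen F p k)) = χ (W k) • gen F p k) {m : M} {a : SuperPoly F p}
    (ha : a ∈ homog F p W m) : D (D a) = χ m • a := by
  refine homog_le_of_mul_gen_mem
    (N := fun m => LinearMap.eqLocus (D ∘ₗ D) (χ m • LinearMap.id))
    (by simp [hD.map_one]) (fun m k a _ ha => ?_) m ha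
  have ha : D (D a) = χ m • a := ha
  change D (D (a * gen F p k)) = χ (m + W k) • (a * gen F p k)
  rw [hD.map_map_mul a (gen_mem_homog F p p k), ha, map_map_gen, mul_smul_comm, smul_mul_assoc,
    ← add_smul, map_add, add_comm]

end IsOddDerivation

namespace CoordD

section Tensor

variable {F : Type u} [Field F] {A : Type v} {B : Type w} [Ring A] [Ring B] [Algebra F A]
  [Algebra F B] {𝒜 : ZMod 2 → Submodule F A} {ℬ : ZMod 2 → Submodule F B} [GradedAlgebra 𝒜]
  [GradedAlgebra ℬ]

theorem add_tmul (a a' : A) (b : B) :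
    ((a + a') ᵍ⊗ₜ[F] b : 𝒜 ᵍ⊗[F] ℬ) = a ᵍ⊗ₜ[F] b + a' ᵍ⊗ₜ[F] b := by
  rw [GradedTensorProduct.tmul, TensorProduct.add_tmul, map_add]

theorem smul_tmul (c : F) (a : A) (b : B) :
    ((c • a) ᵍ⊗ₜ[F] b : 𝒜 ᵍ⊗[F] ℬ) = c • (a ᵍ⊗ₜ[F] b) := by
  rw [GradedTensorProduct.tmul, ← TensorProduct.smul_tmul', map_smul]

theorem units_smul_tmul (ε : ℤˣ) (a : A) (b : B) :
    ((ε • a) ᵍ⊗ₜ[F] b : 𝒜 ᵍ⊗[F] ℬ) = ε • (a ᵍ⊗ₜ[F] b) := by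
  rcases Int.units_eq_one_or ε with rfl | rfl
  · simp only [one_smul]
  · rw [Units.neg_smul, one_smul, neg_tmul, Units.neg_smul, one_smul]

end Tensor

variable {F : Type u} [Field F] {X : Type v} [CommGroup X]

theorem chr_mul_chr_mul_z (g k : X) : chr F g * (chr F k * z F X) = chr F (g * k) * z F X := by
  rw [chr_mul, mul_assoc]

theorem chr_mul_z_mul_chr (g k : X) : chr F g * z F X * chr F k = chr F (g * k) * z F X := by
  rw [chr_mul, mul_right_comm]

theorem chr_mul_z_mul_chr_mul_z (g k : X) : chr F g * z F X * (chr F k * z F X) = 0 := by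
  rw [mul_mul_mul_comm, z_mul_z, mul_zero]

theorem tmul_chr_add_mul_tmul_chr_add {A : Type w} [Ring A] [Algebra F A]
    {𝒜 : ZMod 2 → Submodule F A} [GradedAlgebra 𝒜] {i : ZMod 2} (a a' : A) {b b' : A}
    (hb : b ∈ 𝒜 i) (hb' : b' ∈ 𝒜 (i + 1)) (g k : X) :
    ((a ᵍ⊗ₜ[F] chr F g + a' ᵍ⊗ₜ[F] (chr F g * z F X)) *
        (b ᵍ⊗ₜ[F] chr F k + b' ᵍ⊗ₜ[F] (chr F k * z F X)) : 𝒜 ᵍ⊗[F] parity F X) =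
      (a * b) ᵍ⊗ₜ[F] chr F (g * k) +
        (a * b' + (-1 : ℤˣ) ^ i • (a' * b)) ᵍ⊗ₜ[F] (chr F (g * k) * z F X) := by
  rw [add_mul, mul_add, mul_add, tmul_mul_tmul _ _ (chr_mem F g) hb,
    tmul_mul_tmul _ _ (chr_mem F g) hb', tmul_mul_tmul _ _ (chr_mul_z_mem F g) hb,
    tmul_mul_tmul _ _ (chr_mul_z_mem F g) hb', ← chr_mul, chr_mul_chr_mul_z, chr_mul_z_mul_chr,
    chr_mul_z_mul_chr_mul_z, tmul_zero, add_tmul, units_smul_tmul]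
  simp only [zero_mul, one_mul, uzpow_zero, one_smul, smul_zero, add_zero, add_assoc]

end CoordD

/-- The restriction of `x ∈ Lie(D)` to `X`, as a homomorphism from `X`, written additively like the
weights of `SuperPoly.homog`, to the additive group of `F`. -/
noncomputable def LieD.evalAddHom {F : Type u} [Field F] {X : Type v} [CommGroup X]
    (x : LieD F X) : Additive X →+ F where
  toFun g := LieD.eval x g.toMul
  map_zero' := LieD.eval_one x
  map_add' g k := LieD.eval_mul x g.toMul k.toMul

namespace FV

/-- The space of weight `g ∈ X` in `F[V]` for the action of `D`: the span of the products of
generators whose weights have product `g`, the generator `f_{j,a}` having weight `h_j`. -/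
noncomputable def weightSpace (F : Type u) [Field F] {X : Type v} [CommGroup X] {s : ℕ}
    (h : Fin s → X) (g : X) : Submodule F (FV F s) :=
  SuperPoly.homog F (fun k : Fin s × ZMod 2 => k.2) (fun k => Additive.ofMul (h k.1))
    (Additive.ofMul g)

section Coaction

variable {F : Type u} [Field F] {X : Type v} [CommGroup X]

theorem phiFunctional_chr (g : X) : phiFunctional F X (CoordD.chr F g) = 0 := by
  simp [phiFunctional, CoordD.chr]

theorem phiFunctional_chr_mul_z (g : X) :
    phiFunctional F X (CoordD.chr F g * CoordD.z F X) = 1 := by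
  simp [phiFunctional, CoordD.chr, CoordD.z, MonoidAlgebra.lift_of, -MonoidAlgebra.of_apply]

variable (x : LieD F X) {s : ℕ} (h : Fin s → X)

theorem iSup_weightSpace : ⨆ g, weightSpace F h g = ⊤ :=
  SuperPoly.iSup_homog F _ fun k : Fin s × ZMod 2 => Additive.ofMul (h k.1)

variable {x h} in
theorem coactLin_eq_iff {a a₀ a₁ : FV F s} {u v : CoordD F X} :
    coactLin x h a = a₀ ⊗ₜ[F] u + a₁ ⊗ₜ[F] v ↔
      coact x h a = a₀ ᵍ⊗ₜ[F] u + a₁ ᵍ⊗ₜ[F] v :=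
  (GradedTensorProduct.of F (parity F s) (CoordD.parity F X)).symm_apply_eq

variable {x h} in
theorem phi_eq_of_coact_eq {a a' : FV F s} {g : X}
    (coact_eq : coact x h a =
      a ᵍ⊗ₜ[F] CoordD.chr F g + a' ᵍ⊗ₜ[F] (CoordD.chr F g * CoordD.z F X)) :
    phi x h a = a' := by
  rw [phi, LinearMap.comp_apply, LinearMap.comp_apply, coactLin_eq_iff.2 coact_eq, map_add,
    TensorProduct.map_tmul, TensorProduct.map_tmul, phiFunctional_chr,
    phiFunctional_chr_mul_z]
  simp

theorem phi_f_zero (j : Fin s) : phi x h (f F j 0) = LieD.eval x (h j) • f F j 1 :=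
  phi_eq_of_coact_eq (g := h j) (by rw [coact_f_zero, CoordD.smul_tmul])

theorem phi_f_one (j : Fin s) : phi x h (f F j 1) = f F j 0 :=
  phi_eq_of_coact_eq (g := h j) (by rw [coact_f_one, add_comm])

theorem exists_coact_f_eq (j : Fin s) (i : ZMod 2) :
    ∃ c : F, coact x h (f F j i) = f F j i ᵍ⊗ₜ[F] CoordD.chr F (h j) +
      (c • f F j (i + 1)) ᵍ⊗ₜ[F] (CoordD.chr F (h j) * CoordD.z F X) := by
  obtain ⟨c, hc⟩ := coactGen_eq x h j i
  refine ⟨c, ?_⟩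
  rw [CoordD.smul_tmul, ← hc]
  exact SuperPoly.lift_gen _ _ _ _

theorem exists_phi_f_eq_smul (j : Fin s) (i : ZMod 2) :
    ∃ c : F, phi x h (f F j i) = c • f F j (i + 1) :=
  (exists_coact_f_eq x h j i).imp fun _ => phi_eq_of_coact_eq

theorem coact_f (j : Fin s) (i : ZMod 2) :
    coact x h (f F j i) = f F j i ᵍ⊗ₜ[F] CoordD.chr F (h j) +
      phi x h (f F j i) ᵍ⊗ₜ[F] (CoordD.chr F (h j) * CoordD.z F X) := by
  obtain ⟨c, coact_eq⟩ := exists_coact_f_eq x h j i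
  rw [phi_eq_of_coact_eq coact_eq, coact_eq]

theorem phi_phi_f (j : Fin s) (i : ZMod 2) :
    phi x h (phi x h (f F j i)) = LieD.eval x (h j) • f F j i := by
  obtain rfl | rfl : i = 0 ∨ i = 1 := by revert i; decide
  · rw [phi_f_zero, map_smul, phi_f_one]
  · rw [phi_f_one, phi_f_zero]

theorem phi_f_mem_homog {M : Type w} [AddCommMonoid M] {W : Fin s × ZMod 2 → M} {δ : M}
    (hW : ∀ j i, W (j, i + 1) = W (j, i) + δ) (j : Fin s) (i : ZMod 2) :
    phi x h (f F j i) ∈ SuperPoly.homog F (fun k : Fin s × ZMod 2 => k.2) W (W (j, i) + δ) := by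
  obtain ⟨c, hc⟩ := exists_phi_f_eq_smul x h j i
  rw [hc, ← hW]
  exact Submodule.smul_mem _ c (SuperPoly.gen_mem_homog F _ W (j, i + 1))

variable {x h} in
theorem coact_mul_f {a : FV F s} {g : X}
    (coact_eq : coact x h a = a ᵍ⊗ₜ[F] CoordD.chr F g +
      phi x h a ᵍ⊗ₜ[F] (CoordD.chr F g * CoordD.z F X)) (j : Fin s) (i : ZMod 2) :
    coact x h (a * f F j i) = (a * f F j i) ᵍ⊗ₜ[F] CoordD.chr F (g * h j) +
      (a * phi x h (f F j i) + (-1 : ℤˣ) ^ i • (phi x h a * f F j i)) ᵍ⊗ₜ[F]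
        (CoordD.chr F (g * h j) * CoordD.z F X) := by
  rw [map_mul, coact_eq, coact_f]
  exact CoordD.tmul_chr_add_mul_tmul_chr_add _ _ (f_mem F j i)
    (phi_f_mem_homog x h (fun _ _ => rfl) j i) g (h j)

theorem coact_one : coact x h 1 = 1 ᵍ⊗ₜ[F] CoordD.chr F 1 +
    (0 : FV F s) ᵍ⊗ₜ[F] (CoordD.chr F 1 * CoordD.z F X) := by
  rw [CoordD.zero_tmul, add_zero, map_one, CoordD.chr_one]
  rfl

theorem phi_one : phi x h 1 = 0 :=
  phi_eq_of_coact_eq (coact_one x h)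

variable {h}

theorem coact_of_mem_weightSpace {g : X} {a : FV F s} (ha : a ∈ weightSpace F h g) :
    coact x h a = a ᵍ⊗ₜ[F] CoordD.chr F g +
      phi x h a ᵍ⊗ₜ[F] (CoordD.chr F g * CoordD.z F X) := by
  let N (g : Additive X) : Submodule F (FV F s) := LinearMap.eqLocus (coactLin x h)
    ((TensorProduct.mk F _ _).flip (CoordD.chr F g.toMul) +
      (TensorProduct.mk F _ _).flip (CoordD.chr F g.toMul * CoordD.z F X) ∘ₗ phi x h)
  have mem_N {g a} : a ∈ N g ↔ coact x h a = a ᵍ⊗ₜ[F] CoordD.chr F g.toMul +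
      phi x h a ᵍ⊗ₜ[F] (CoordD.chr F g.toMul * CoordD.z F X) := coactLin_eq_iff
  refine mem_N.1 (SuperPoly.homog_le_of_mul_gen_mem (N := N) ?_ (fun g k a _ ha => ?_) _ ha)
  · rw [mem_N, phi_one]
    exact coact_one x h
  · have coact_eq := coact_mul_f (mem_N.1 ha) k.1 k.2
    rw [← phi_eq_of_coact_eq coact_eq] at coact_eq
    exact mem_N.2 coact_eq

variable (h)

theorem phi_mul_f (a : FV F s) (j : Fin s) (i : ZMod 2) :
    phi x h (a * f F j i) =
      a * phi x h (f F j i) + (-1 : ℤˣ) ^ i • (phi x h a * f F j i) := by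
  suffices ⨆ g, weightSpace F h g ≤ LinearMap.eqLocus
      (phi x h ∘ₗ LinearMap.mulRight F (f F j i))
      (LinearMap.mulRight F (phi x h (f F j i)) +
        (-1 : ℤˣ) ^ i • (LinearMap.mulRight F (f F j i) ∘ₗ phi x h)) from
    this (iSup_weightSpace (F := F) h ▸ Submodule.mem_top)
  exact iSup_le fun g a ha => phi_eq_of_coact_eq (coact_mul_f (coact_of_mem_weightSpace x ha) j i)

theorem isOddDerivation_phi : IsOddDerivation (parity F s) (phi x h) :=
  SuperPoly.isOddDerivation_of_map_mul_gen (phi_one x h) (fun a k => phi_mul_f x h a k.1 k.2)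
    fun k => phi_f_mem_homog x h (fun _ _ => rfl) k.1 k.2

variable {h}

theorem phi_mem_degree {d : ℕ} {a : FV F s} (ha : a ∈ degree F s d) :
    phi x h a ∈ degree F s d :=
  (isOddDerivation_phi x h).map_mem_homog (δ := 0)
    (fun k => phi_f_mem_homog x h (fun _ _ => rfl) k.1 k.2) ha

theorem phi_mem_weightSpace {g : X} {a : FV F s} (ha : a ∈ weightSpace F h g) :
    phi x h a ∈ weightSpace F h g := by
  rw [weightSpace, ← add_zero (Additive.ofMul g)]
  exact (isOddDerivation_phi x h).map_mem_homog
    (fun k => phi_f_mem_homog x h (fun _ _ => (add_zero _).symm) k.1 k.2) ha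

theorem phi_phi_of_mem_weightSpace {g : X} {a : FV F s} (ha : a ∈ weightSpace F h g) :
    phi x h (phi x h a) = LieD.eval x g • a :=
  (isOddDerivation_phi x h).map_map_eq_smul (LieD.evalAddHom x)
    (fun k => phi_phi_f x h k.1 k.2) ha

theorem coactLin_of_mem_weightSpace {g : X} {a : FV F s} (ha : a ∈ weightSpace F h g) :
    coactLin x h a = a ⊗ₜ[F] CoordD.chr F g +
      phi x h a ⊗ₜ[F] (CoordD.chr F g * CoordD.z F X) :=
  coactLin_eq_iff.2 (coact_of_mem_weightSpace x ha)

theorem coactD_of_mem_weightSpace {g : X} {a : FV F s} (ha : a ∈ weightSpace F h g) :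
    coactD x h a = a ⊗ₜ[F] MonoidAlgebra.of F X g := by
  rw [coactD, LinearMap.comp_apply, coactLin_of_mem_weightSpace x ha, map_add,
    TensorProduct.map_tmul, TensorProduct.map_tmul]
  simp [CoordD.chr, CoordD.z, -MonoidAlgebra.of_apply]

variable (h)

theorem invariantsD_eq_weightSpace_one : invariantsD x h = weightSpace F h 1 := by
  refine le_antisymm (fun a ha => ?_) fun a ha => ?_
  · let coeffOne : MonoidAlgebra F X →ₗ[F] F :=
      Finsupp.lapply 1 ∘ₗ (MonoidAlgebra.coeffLinearEquiv F).toLinearMap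
    let project : FV F s →ₗ[F] FV F s := (TensorProduct.rid F (FV F s)).toLinearMap ∘ₗ
      TensorProduct.map LinearMap.id coeffOne ∘ₗ coactD x h
    have coactD_eq : coactD x h a = a ⊗ₜ[F] MonoidAlgebra.of F X 1 := by rwa [map_one]
    have project_eq : project a = a := by simp [project, coeffOne, coactD_eq]
    have project_mem : ⨆ g, weightSpace F h g ≤ (weightSpace F h 1).comap project := by
      refine iSup_le fun g a ha => ?_
      rw [Submodule.mem_comap]
      by_cases hg : g = 1
      · subst hg
        simpa [project, coeffOne, coactD_of_mem_weightSpace x ha] using ha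
      · simp [project, coeffOne, coactD_of_mem_weightSpace x ha, hg]
    rw [← project_eq]
    exact project_mem (iSup_weightSpace (F := F) h ▸ Submodule.mem_top)
  · change coactD x h a = a ⊗ₜ[F] 1
    rw [coactD_of_mem_weightSpace x ha, map_one]

theorem map_phi_invariantsD_le : (invariantsD x h).map (phi x h) ≤ invariantsD x h := by
  rw [invariantsD_eq_weightSpace_one, Submodule.map_le_iff_le_comap]
  exact fun a ha => phi_mem_weightSpace x ha

variable {h}

theorem phi_phi_of_mem_invariantsD {a : FV F s} (ha : a ∈ invariantsD x h) :
    phi x h (phi x h a) = 0 := by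
  rw [invariantsD_eq_weightSpace_one] at ha
  rw [phi_phi_of_mem_weightSpace x ha, LieD.eval_one, zero_smul]

variable (h)

theorem invariants_eq_inf_ker : invariants x h = invariantsD x h ⊓ LinearMap.ker (phi x h) := by
  ext a
  refine ⟨fun ha => ?_, fun ⟨ha, phi_eq⟩ => ?_⟩
  · have coactLin_eq : coactLin x h a = a ⊗ₜ[F] 1 := ha
    constructor
    · change coactD x h a = a ⊗ₜ[F] 1
      rw [coactD, LinearMap.comp_apply, coactLin_eq, TensorProduct.map_tmul]
      simp
    · change phi x h a = 0
      rw [phi, LinearMap.comp_apply, LinearMap.comp_apply, coactLin_eq, TensorProduct.map_tmul,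
        ← CoordD.chr_one, phiFunctional_chr]
      simp
  · rw [invariantsD_eq_weightSpace_one] at ha
    change coactLin x h a = a ⊗ₜ[F] 1
    rw [coactLin_of_mem_weightSpace x ha, LinearMap.mem_ker.1 phi_eq, TensorProduct.zero_tmul,
      add_zero, CoordD.chr_one]

theorem invariantsD_le_span_homogeneous :
    invariantsD x h ≤
      Submodule.span F {a | a ∈ invariantsD x h ∧ ∃ d, a ∈ degree F s d} := by
  rw [invariantsD_eq_weightSpace_one]
  exact SuperPoly.homog_le_span_inter_homog (fun _ => 1) _

end Coaction

section Differential

variable {F : Type u} [Field F] {s : ℕ} {A : Submodule F (FV F s)} {φ : FV F s →ₗ[F] FV F s}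

theorem exists_isAdaptedBasis
    (A_le : A ≤ Submodule.span F {a | a ∈ A ∧ ∃ d, a ∈ degree F s d}) (map_le : A.map φ ≤ A)
    (map_degree : ∀ d, ∀ a ∈ degree F s d, φ a ∈ degree F s d) :
    ∃ (I₁ I₂ : Type u) (b : I₁ ⊕ I₂ → FV F s), IsAdaptedBasis A φ b := by
  let homogeneous (B : Submodule F (FV F s)) : Set (FV F s) :=
    {a | a ∈ B ∧ ∃ d, a ∈ degree F s d}
  have span_homogeneous_le (B) : Submodule.span F (homogeneous B) ≤ B :=
    Submodule.span_le.2 fun a ha => ha.1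
  have map_le_span : A.map φ ≤ Submodule.span F (homogeneous (A.map φ)) := by
    refine (Submodule.map_mono A_le).trans ?_
    rw [Submodule.map_span]
    refine Submodule.span_mono ?_
    rintro _ ⟨a, ⟨ha, d, hd⟩, rfl⟩
    exact ⟨Submodule.mem_map_of_mem ha, d, map_degree d a hd⟩
  obtain ⟨I₁, I₂, b, hb, mem_b, span_inl, span_b⟩ := exists_linearIndependent_sum_span_eq (K := F)
    (show homogeneous (A.map φ) ⊆ homogeneous A from fun a ha => ⟨map_le ha.1, ha.2⟩)
  exact ⟨I₁, I₂, b,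
    { homogeneous i := (mem_b i).2
      linearIndependent := hb
      span_eq := span_b.trans (le_antisymm (span_homogeneous_le A) A_le)
      span_image := span_inl.trans (le_antisymm (span_homogeneous_le _) map_le_span) }⟩

theorem minDegree_inf_ker (map_le : A.map φ ≤ A)
    (map_degree : ∀ d, ∀ a ∈ degree F s d, φ a ∈ degree F s d) (map_map : ∀ a ∈ A, φ (φ a) = 0) :
    minDegree (A ⊓ LinearMap.ker φ) = minDegree A := by
  suffices ∀ d, A ⊓ LinearMap.ker φ ⊓ degree F s d ≠ ⊥ ↔ A ⊓ degree F s d ≠ ⊥ by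
    simp only [minDegree, this]
  intro d
  refine ⟨fun hd => ne_bot_of_le_ne_bot hd (inf_le_inf_right _ inf_le_left), fun hd => ?_⟩
  obtain ⟨a, ⟨haA, had⟩, a_ne⟩ := (Submodule.ne_bot_iff _).1 hd
  rw [Submodule.ne_bot_iff]
  by_cases hφ : φ a = 0
  · exact ⟨a, ⟨⟨haA, hφ⟩, had⟩, a_ne⟩
  · exact ⟨φ a, ⟨⟨map_le (Submodule.mem_map_of_mem haA), map_map a haA⟩, map_degree d a had⟩, hφ⟩

variable {I₁ I₂ : Type w} {b : I₁ ⊕ I₂ → FV F s}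

theorem isCoeffMatrix_iff {C : Matrix I₂ I₁ F} : IsCoeffMatrix φ b C ↔
    ∀ i, ∃ r : I₁ →₀ F, C i = r ∧
      φ (b (Sum.inr i)) = Finsupp.linearCombination F (b ∘ Sum.inl) r := by
  have finsum_eq (r : I₁ →₀ F) :
      ∑ᶠ j, r j • b (Sum.inl j) = Finsupp.linearCombination F (b ∘ Sum.inl) r :=
    finsum_eq_sum_of_support_subset _ fun j hj =>
      Finsupp.mem_support_iff.2 fun hr => hj (by simp only [hr, zero_smul])
  refine forall_congr' fun i => ⟨fun ⟨finite_row, map_eq⟩ => ?_, fun ⟨r, hr, map_eq⟩ => ?_⟩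
  · exact ⟨Finsupp.ofSupportFinite (C i) finite_row, rfl,
      map_eq.trans (finsum_eq (Finsupp.ofSupportFinite (C i) finite_row))⟩
  · rw [hr]
    exact ⟨r.hasFiniteSupport, map_eq.trans (finsum_eq r).symm⟩

namespace IsAdaptedBasis

theorem linearIndependent_inl (hb : IsAdaptedBasis A φ b) :
    LinearIndependent F (b ∘ Sum.inl) :=
  hb.linearIndependent.comp _ Sum.inl_injective

theorem mem (hb : IsAdaptedBasis A φ b) (i : I₁ ⊕ I₂) : b i ∈ A :=
  hb.span_eq ▸ Submodule.subset_span (Set.mem_range_self i)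

theorem existsUnique_isCoeffMatrix (hb : IsAdaptedBasis A φ b) :
    ∃! C : Matrix I₂ I₁ F, IsCoeffMatrix φ b C := by
  have exists_row (i) : ∃ r : I₁ →₀ F,
      Finsupp.linearCombination F (b ∘ Sum.inl) r = φ (b (Sum.inr i)) := by
    rw [← LinearMap.mem_range, Finsupp.range_linearCombination, hb.span_image]
    exact Submodule.mem_map_of_mem (hb.mem _)
  choose r hr using exists_row
  refine ⟨fun i => r i, isCoeffMatrix_iff.2 fun i => ⟨r i, rfl, (hr i).symm⟩, fun C hC => ?_⟩
  funext i
  obtain ⟨r', hr', map_eq⟩ := isCoeffMatrix_iff.1 hC i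
  rw [hr', hb.linearIndependent_inl (map_eq.symm.trans (hr i).symm)]

theorem map_sum_eq_zero_iff (hb : IsAdaptedBasis A φ b) {C : Matrix I₂ I₁ F}
    (hC : IsCoeffMatrix φ b C) (d : I₂ →₀ F) :
    φ (d.sum fun i c => c • b (Sum.inr i)) = 0 ↔ ∀ j, (d.sum fun i c => c * C i j) = 0 := by
  choose r hr map_eq using isCoeffMatrix_iff.1 hC
  have map_sum_eq : φ (d.sum fun i c => c • b (Sum.inr i)) =
      Finsupp.linearCombination F (b ∘ Sum.inl) (d.sum fun i c => c • r i) := by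
    simp only [Finsupp.sum, map_sum, map_smul, map_eq]
  rw [map_sum_eq, map_eq_zero_iff _ hb.linearIndependent_inl, Finsupp.ext_iff]
  simp [Finsupp.sum, Finsupp.finsetSum_apply, hr]

theorem inf_ker_eq_span (hb : IsAdaptedBasis A φ b) (map_le : A.map φ ≤ A)
    (map_map : ∀ a ∈ A, φ (φ a) = 0) {C : Matrix I₂ I₁ F} (hC : IsCoeffMatrix φ b C) :
    A ⊓ LinearMap.ker φ = Submodule.span F (Set.range (b ∘ Sum.inl) ∪
      {a | ∃ d : I₂ →₀ F, (∀ j : I₁, (d.sum fun i c => c * C i j) = 0) ∧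
        a = d.sum fun i c => c • b (Sum.inr i)}) := by
  have span_inl_le : Submodule.span F (Set.range (b ∘ Sum.inl)) ≤ A ⊓ LinearMap.ker φ := by
    rw [hb.span_image]
    refine le_inf map_le ?_
    rintro _ ⟨c, hc, rfl⟩
    exact map_map c hc
  refine le_antisymm ?_ (Submodule.span_le.2 (Set.union_subset
    (Submodule.span_le.1 span_inl_le) ?_))
  · rintro a ⟨haA, ha⟩
    rw [← hb.span_eq, ← Sum.elim_comp_inl_inr b, Set.Sum.elim_range, Submodule.span_union,
      SetLike.mem_coe, Submodule.mem_sup] at haA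
    obtain ⟨y, hy, z, hz, rfl⟩ := haA
    rw [← Finsupp.range_linearCombination] at hz
    obtain ⟨d, rfl⟩ := hz
    rw [SetLike.mem_coe, LinearMap.mem_ker, map_add, (span_inl_le hy).2, zero_add] at ha
    exact add_mem (Submodule.span_mono Set.subset_union_left hy)
      (Submodule.subset_span (Or.inr ⟨d, (hb.map_sum_eq_zero_iff hC d).1 ha, rfl⟩))
  · rintro _ ⟨d, hd, rfl⟩
    exact ⟨Submodule.sum_mem _ fun i _ => Submodule.smul_mem _ _ (hb.mem _),
      (hb.map_sum_eq_zero_iff hC d).2 hd⟩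

end IsAdaptedBasis

end Differential

end FV

theorem mainTheorem2_general {F : Type u} [Field F] {X : Type v} [CommGroup X]
    (x : LieD F X) {s : ℕ} (h : Fin s → X) :
    ((∀ j : Fin s, FV.phi x h (FV.f F j 0) = LieD.eval x (h j) • FV.f F j 1 ∧
        FV.phi x h (FV.f F j 1) = FV.f F j 0) ∧
      (∀ i : ZMod 2, ∀ a ∈ FV.parity F s i, FV.phi x h a ∈ FV.parity F s (i + 1)) ∧
      (∀ i : ZMod 2, ∀ a : FV F s, ∀ b ∈ FV.parity F s i,
        FV.phi x h (a * b) = a * FV.phi x h b + (-1 : ℤˣ) ^ i • (FV.phi x h a * b))) ∧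
    (∀ d : ℕ, ∀ a ∈ FV.degree F s d, FV.phi x h a ∈ FV.degree F s d) ∧
    (∀ a ∈ FV.invariantsD x h, FV.phi x h a ∈ FV.invariantsD x h) ∧
    (∀ a : FV F s, a ∈ FV.invariants x h ↔ a ∈ FV.invariantsD x h ∧ FV.phi x h a = 0) ∧
    (∃ (I₁ I₂ : Type u) (b : I₁ ⊕ I₂ → FV F s),
      FV.IsAdaptedBasis (FV.invariantsD x h) (FV.phi x h) b) ∧
    (∀ (I₁ I₂ : Type w) (b : I₁ ⊕ I₂ → FV F s),
      FV.IsAdaptedBasis (FV.invariantsD x h) (FV.phi x h) b →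
      (∃! C : Matrix I₂ I₁ F, FV.IsCoeffMatrix (FV.phi x h) b C) ∧
      ∀ C : Matrix I₂ I₁ F, FV.IsCoeffMatrix (FV.phi x h) b C →
        FV.invariants x h = Submodule.span F (Set.range (b ∘ Sum.inl) ∪
          {a | ∃ d : I₂ →₀ F, (∀ j : I₁, (d.sum fun i c => c * C i j) = 0) ∧
            a = d.sum fun i c => c • b (Sum.inr i)})) ∧
    FV.minDegree (FV.invariantsD x h) = FV.minDegree (FV.invariants x h) := by
  have map_le := FV.map_phi_invariantsD_le x h
  have map_degree : ∀ d, ∀ a ∈ FV.degree F s d, FV.phi x h a ∈ FV.degree F s d :=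
    fun _ _ => FV.phi_mem_degree x
  have phi_phi : ∀ a ∈ FV.invariantsD x h, FV.phi x h (FV.phi x h a) = 0 :=
    fun _ => FV.phi_phi_of_mem_invariantsD x
  rw [FV.invariants_eq_inf_ker]
  exact ⟨⟨fun j => ⟨FV.phi_f_zero x h j, FV.phi_f_one x h j⟩,
      (FV.isOddDerivation_phi x h).map_mem, (FV.isOddDerivation_phi x h).map_mul⟩,
    map_degree, Submodule.map_le_iff_le_comap.1 map_le, fun _ => Iff.rfl,
    FV.exists_isAdaptedBasis (FV.invariantsD_le_span_homogeneous x h) map_le map_degree,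
    fun _ _ _ hb => ⟨hb.existsUnique_isCoeffMatrix, fun _ => hb.inf_ker_eq_span map_le phi_phi⟩,
    (FV.minDegree_inf_ker map_le map_degree phi_phi).symm⟩

theorem mainTheorem2 {F : Type u} [Field F] (hF : (2 : F) ≠ 0)
    {X : Type v} [CommGroup X] [Group.FG X]
    (hD : ConnectedSpace (PrimeSpectrum (MonoidAlgebra F X)))
    (x : LieD F X) {s : ℕ} (h : Fin s → X) :
    -- `φ` is an odd superderivation of `F[V]`
    ((∀ j : Fin s, FV.phi x h (FV.f F j 0) = LieD.eval x (h j) • FV.f F j 1 ∧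
        FV.phi x h (FV.f F j 1) = FV.f F j 0) ∧
      (∀ i : ZMod 2, ∀ a ∈ FV.parity F s i, FV.phi x h a ∈ FV.parity F s (i + 1)) ∧
      (∀ i : ZMod 2, ∀ a : FV F s, ∀ b ∈ FV.parity F s i,
        FV.phi x h (a * b) = a * FV.phi x h b + (-1 : ℤˣ) ^ i • (FV.phi x h a * b))) ∧
    -- it preserves degrees and maps `A = F[V]^D` to itself
    (∀ d : ℕ, ∀ a ∈ FV.degree F s d, FV.phi x h a ∈ FV.degree F s d) ∧
    (∀ a ∈ FV.invariantsD x h, FV.phi x h a ∈ FV.invariantsD x h) ∧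
    -- the invariants of `D_{1,x}` are the kernel of `φ` on `A`
    (∀ a : FV F s, a ∈ FV.invariants x h ↔ a ∈ FV.invariantsD x h ∧ FV.phi x h a = 0) ∧
    -- adapted homogeneous bases of `A` exist, and the invariants are described by each of them
    (∃ (I₁ I₂ : Type u) (b : I₁ ⊕ I₂ → FV F s),
      FV.IsAdaptedBasis (FV.invariantsD x h) (FV.phi x h) b) ∧
    (∀ (I₁ I₂ : Type w) (b : I₁ ⊕ I₂ → FV F s),
      FV.IsAdaptedBasis (FV.invariantsD x h) (FV.phi x h) b →
      (∃! C : Matrix I₂ I₁ F, FV.IsCoeffMatrix (FV.phi x h) b C) ∧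
      ∀ C : Matrix I₂ I₁ F, FV.IsCoeffMatrix (FV.phi x h) b C →
        FV.invariants x h = Submodule.span F (Set.range (b ∘ Sum.inl) ∪
          {a | ∃ d : I₂ →₀ F, (∀ j : I₁, (d.sum fun i c => c * C i j) = 0) ∧
            a = d.sum fun i c => c • b (Sum.inr i)})) ∧
    -- the minimal degrees agree
    FV.minDegree (FV.invariantsD x h) = FV.minDegree (FV.invariants x h) := by
  exact mainTheorem2_general x h
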